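/- **Setting.** A lens potential is a function $\psi$ on $\mathbb R^2$ whose set $A_\psi$ of singularities (points $a$ with $\psi(x)\to-\infty$ or $\nabla^2\psi(x)\to+\infty$ as $x\to a$) is finite and which is $C^\infty$ on $L_\psi=\mathbb R^2\setminus A_\psi$. Its lensing map is $\eta(x)=x-\nabla\psi(x)$ and its time delay functions are $T_y(x)=\tfrac12|x-y|^2-\psi(x)$ for $x\in L_\psi$. The lensed images of a source at $y\in\mathbb R^2$ are the $x\in L_\psi$ with $\eta(x)=y$; such an image is a minimum (maximum) image if $\operatorname{Hess}T_y(x)$ is positive (negative) definite. For $D\subseteq\mathbb R^2$ let $N_+(D,y)\in\{0,1,2,\dots,\infty\}$ be the number of minimum images plus the number of maximum images of $y$ in $D$ (the positive parity images). Let $\psi$ be a random lens potential on a probability space: $\psi(x)$ is a random variable for every $x\in\mathbb R^2$, and almost every realization is a lens potential. Write $E$ for the expectation over the random lens. Let $\{\mathfrak S\}$ be a countable family of compact sets that covers the light source plane $\mathbb R^2$, all of the same area $|\mathfrak S_0|>0$ and with pairwise intersections of area zero. For each $\mathfrak S$ let $Y_{\mathfrak S}$ be a random source position, uniformly distributed on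 $\mathfrak S$ and independent of the lens. The global expectation of the number of positive parity images in $D$ is the mean of $E[N_+(D,y)]$ over each source position $y=Y_{\mathfrak S}$, accumulated over the family (one source per set $\mathfrak S$): $$\widehat E[N_+(D,Y;\mathfrak S)]_{\{\mathfrak S\}}=\sum_{\mathfrak S}E_{Y_{\mathfrak S}}\big[E[N_+(D,y)]_{y=Y_{\mathfrak S}}\big]=\sum_{\mathfrak S}\frac1{|\mathfrak S_0|}\int_{\mathfrak S}E[N_+(D,y)]\,dy\in[0,\infty].$$ **Theorem (Global expected number of positive parity images).** Let $D\subset\mathbb R^2$ be a closed disk of positive radius. Then the number $N_+(D,y)$ and the function $\det[\operatorname{Jac}\eta](x)\,\mathbf 1_{\{\det[\operatorname{Jac}\eta]>0\}}(x)$ (set equal to $0$ at singularities) are measurable up to null sets, jointly in the random lens and in $y$, respectively $x$, and, as an identity in $[0,\infty]$, $$\widehat E[N_+(D,Y;\mathfrak S)]_{\{\mathfrak S\}}=\frac1{|\mathfrak S_0|}\int_D E\Big[\det[\operatorname{Jac}\eta](x)\,\mathbf 1_{\{\det[\operatorname{Jac}\eta]>0\}}(x)\Big]\,dx .$$ -/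

import Mathlib

open MeasureTheory Filter Topology
open scoped ENNReal

noncomputable section

namespace Lensing

/-- The Euclidean plane, used both as the plane containing the lens and as the light source plane. -/
abbrev Plane : Type := EuclideanSpace ℝ (Fin 2)

/-- A singularity of a potential `ψ`: a point `a` such that `ψ x → -∞` or `∇² ψ x → ∞`
as `x → a`. -/
def IsSingularity (ψ : Plane → ℝ) (a : Plane) : Prop :=
  Tendsto ψ (𝓝[≠] a) atBot ∨ Tendsto (Laplacian.laplacian ψ : Plane → ℝ) (𝓝[≠] a) atTop

/-- The set `A` of singularities of `ψ`. -/
def singularSet (ψ : Plane → ℝ) : Set Plane := {a | IsSingularity ψ a}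

/-- The lens plane `L = ℝ² - A`. -/
def lensPlane (ψ : Plane → ℝ) : Set Plane := (singularSet ψ)ᶜ

/-- A gravitational lens potential: finitely many singularities, and smooth away from them. -/
structure IsLensPotential (ψ : Plane → ℝ) : Prop where
  finite_singularSet : (singularSet ψ).Finite
  smooth : ContDiffOn ℝ ((⊤ : ℕ∞) : WithTop ℕ∞) ψ (lensPlane ψ)

/-- The time delay function `T_y(x) = |x - y|² / 2 - ψ(x)` (meaningful for `x` in the lens plane). -/
def timeDelay (ψ : Plane → ℝ) (y x : Plane) : ℝ := ‖x - y‖ ^ 2 / 2 - ψ x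

/-- The lensing map `η(x) = x - ∇ψ(x)` (meaningful for `x` in the lens plane). -/
def lensingMap (ψ : Plane → ℝ) (x : Plane) : Plane := x - gradient ψ x

/-- `det [Jac η](x)`. -/
def detJac (ψ : Plane → ℝ) (x : Plane) : ℝ := (fderiv ℝ (lensingMap ψ) x).det

/-- The Hessian of `T_y` at `x`, as a bilinear form. -/
def hessTimeDelay (ψ : Plane → ℝ) (y x v w : Plane) : ℝ :=
  fderiv ℝ (fderiv ℝ (timeDelay ψ y)) x v w

/-- The lensed images of a source at `y` are the points of `L` that `η` maps to `y`. -/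
def IsLensedImage (ψ : Plane → ℝ) (y x : Plane) : Prop :=
  x ∈ lensPlane ψ ∧ lensingMap ψ x = y

/-- A minimum image: a lensed image at which `Hess T_y` is nondegenerate of Morse index `0`. -/
def IsMinimumImage (ψ : Plane → ℝ) (y x : Plane) : Prop :=
  IsLensedImage ψ y x ∧ ∀ v : Plane, v ≠ 0 → 0 < hessTimeDelay ψ y x v v

/-- A maximum image: a lensed image at which `Hess T_y` is nondegenerate of Morse index `2`. -/
def IsMaximumImage (ψ : Plane → ℝ) (y x : Plane) : Prop :=
  IsLensedImage ψ y x ∧ ∀ v : Plane, v ≠ 0 → hessTimeDelay ψ y x v v < 0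

/-- `N_+(D, y)`: the number (possibly `∞`) of positive parity images in `D` of a source at `y`,
i.e. the number of minimum images plus the number of maximum images. -/
def numPositiveParity (ψ : Plane → ℝ) (D : Set Plane) (y : Plane) : ℝ≥0∞ :=
  (({x ∈ D | IsMinimumImage ψ y x}.encard + {x ∈ D | IsMaximumImage ψ y x}.encard : ℕ∞) : ℝ≥0∞)

/-- The function `x ↦ det [Jac η](x) · 1_{det [Jac η] > 0}(x)` on `L` (extended by `0` to the
finite set of singularities), as a nonnegative quantity. -/
def posDetJac (ψ : Plane → ℝ) (x : Plane) : ℝ≥0∞ :=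
  {z | z ∈ lensPlane ψ ∧ 0 < detJac ψ z}.indicator (fun z => ENNReal.ofReal (detJac ψ z)) x

/-- A random lens potential on a probability space `(Ω, P)`: a random field almost all of whose
realizations are lens potentials. -/
structure IsRandomLensPotential {Ω : Type*} [MeasurableSpace Ω] (P : Measure Ω)
    (ψ : Ω → Plane → ℝ) : Prop where
  measurable_apply : ∀ x, Measurable fun ω => ψ ω x
  ae_isLensPotential : ∀ᵐ ω ∂P, IsLensPotential (ψ ω)

/-- A covering of the light source plane by nonoverlapping compact sets, all of area `a > 0`. -/
structure IsEqualAreaCover {ι : Type*} (S : ι → Set Plane) (a : ℝ) : Prop where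
  area_pos : 0 < a
  isCompact : ∀ i, IsCompact (S i)
  volume_eq : ∀ i, volume (S i) = ENNReal.ofReal a
  iUnion_eq : ⋃ i, S i = Set.univ
  aedisjoint : Pairwise fun i j => AEDisjoint volume (S i) (S j)

/-- `E[N_+(D, y)]`, the expectation over the random lens, for a fixed source position `y`. -/
def expectedPositiveParity {Ω : Type*} [MeasurableSpace Ω] (P : Measure Ω) (ψ : Ω → Plane → ℝ)
    (D : Set Plane) (y : Plane) : ℝ≥0∞ :=
  ∫⁻ ω, numPositiveParity (ψ ω) D y ∂P

/-- The global expectation of the number of positive parity images in `D` over the family of random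
source positions `Y i`: the mean of `E[N_+(D, y)]` over each `y = Y i`, accumulated over the family
(one source per member of the family). -/
def globalExpectation {Ω Ω' ι : Type*} [MeasurableSpace Ω] [MeasurableSpace Ω'] (P : Measure Ω)
    (Q : Measure Ω') (ψ : Ω → Plane → ℝ) (Y : ι → Ω' → Plane) (D : Set Plane) : ℝ≥0∞ :=
  ∑' i, ∫⁻ ω', expectedPositiveParity P ψ D (Y i ω') ∂Q

end Lensing

end

/-! For one realization, `∇T_y = η - y`, so `Hess T_y` is the Jacobian of `η` and is symmetric. In
the plane a symmetric form is definite exactly when its determinant is positive. Hence `N_+(D, y)`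
is the cardinality of the fibre of `η` over `y` in the part of `D` where `det > 0`. There `η` is
locally injective, and the area formula with multiplicity (`lintegral_encard_fiber`) gives `∫ N_+(D,
y) dy = ∫_D det⁺`. Tonelli inserts the expectation over the lens; averages over sets of equal area
that tile the plane add up to the integral over the plane.

The long part is the joint measurability that Tonelli needs, since only `ω ↦ ψ ω x` for fixed `x` is
known to be measurable. Everything is rebuilt from countable data: `ψ` and its derivatives by
limsups of measurable functions, the lens plane by bounds on a dense sequence (`mem_lensPlane_iff`),
the existence of an image in a compact set by approximate images in that sequence
(`exists_image_iff`), and the count by disjoint small balls (`encard_eq_iSup_smallBall`). -/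

noncomputable section

namespace Lensing

variable {ψ : Plane → ℝ}

/-! ### Smoothness of the lensing map and the Hessian of the time delay -/

theorem IsLensPotential.isOpen_lensPlane (h : IsLensPotential ψ) : IsOpen (lensPlane ψ) :=
  h.finite_singularSet.isClosed.isOpen_compl

theorem IsLensPotential.contDiffAt (h : IsLensPotential ψ) {x : Plane} (hx : x ∈ lensPlane ψ) :
    ContDiffAt ℝ ((⊤ : ℕ∞) : WithTop ℕ∞) ψ x :=
  h.smooth.contDiffAt (h.isOpen_lensPlane.mem_nhds hx)

theorem IsLensPotential.contDiffAt_fderiv (h : IsLensPotential ψ) {x : Plane}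
    (hx : x ∈ lensPlane ψ) : ContDiffAt ℝ ((⊤ : ℕ∞) : WithTop ℕ∞) (fderiv ℝ ψ) x :=
  (h.contDiffAt hx).fderiv_right (by simp)

theorem IsLensPotential.contDiffAt_gradient (h : IsLensPotential ψ) {x : Plane}
    (hx : x ∈ lensPlane ψ) : ContDiffAt ℝ ((⊤ : ℕ∞) : WithTop ℕ∞) (gradient ψ) x :=
  (InnerProductSpace.toDual ℝ Plane).symm.contDiff.contDiffAt.comp x (h.contDiffAt_fderiv hx)

theorem IsLensPotential.contDiffAt_lensingMap (h : IsLensPotential ψ) {x : Plane}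
    (hx : x ∈ lensPlane ψ) : ContDiffAt ℝ ((⊤ : ℕ∞) : WithTop ℕ∞) (lensingMap ψ) x :=
  contDiffAt_id.sub (h.contDiffAt_gradient hx)

theorem IsLensPotential.differentiableAt_lensingMap (h : IsLensPotential ψ) {x : Plane}
    (hx : x ∈ lensPlane ψ) : DifferentiableAt ℝ (lensingMap ψ) x :=
  (h.contDiffAt_lensingMap hx).differentiableAt (by simp)

theorem IsLensPotential.continuousAt_detJac (h : IsLensPotential ψ) {x : Plane}
    (hx : x ∈ lensPlane ψ) : ContinuousAt (detJac ψ) x :=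
  ContinuousLinearMap.continuous_det.continuousAt.comp
    ((h.contDiffAt_lensingMap hx).fderiv_right (m := 0) (by simp)).continuousAt

theorem inner_gradient (x v : Plane) : inner ℝ (gradient ψ x) v = fderiv ℝ ψ x v := by
  rw [gradient, InnerProductSpace.toDual_symm_apply]

theorem fderiv_timeDelay {x : Plane} (hx : DifferentiableAt ℝ ψ x) (y : Plane) :
    fderiv ℝ (timeDelay ψ y) x = innerSL ℝ (lensingMap ψ x - y) := by
  have h1 : HasFDerivAt (fun x : Plane => ‖x - y‖ ^ 2) (2 • innerSL ℝ (x - y)) x := by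
    simpa using ((hasFDerivAt_id x).sub_const y).norm_sq
  have h2 : HasFDerivAt (timeDelay ψ y) ((2 : ℝ)⁻¹ • (2 • innerSL ℝ (x - y)) - fderiv ℝ ψ x) x := by
    have := (h1.const_mul (2 : ℝ)⁻¹).sub hx.hasFDerivAt
    refine this.congr_of_eventuallyEq (Eventually.of_forall fun z => ?_)
    simp [timeDelay]; ring
  rw [h2.fderiv]
  ext v
  simp only [lensingMap, gradient]
  simp [InnerProductSpace.toDual_symm_apply]
  ring

theorem IsLensPotential.hessTimeDelay_eq (h : IsLensPotential ψ) {x : Plane}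
    (hx : x ∈ lensPlane ψ) (y v w : Plane) :
    hessTimeDelay ψ y x v w = inner ℝ (fderiv ℝ (lensingMap ψ) x v) w := by
  have he : fderiv ℝ (timeDelay ψ y) =ᶠ[𝓝 x] fun z => innerSL ℝ (lensingMap ψ z - y) := by
    filter_upwards [h.isOpen_lensPlane.mem_nhds hx] with z hz
    exact fderiv_timeDelay ((h.contDiffAt hz).differentiableAt (by simp)) y
  have hd := (h.differentiableAt_lensingMap hx).hasFDerivAt.sub_const y
  have := (innerSL ℝ (E := Plane)).hasFDerivAt.comp x hd
  rw [hessTimeDelay, he.fderiv_eq]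
  erw [this.fderiv]
  rfl

theorem IsLensPotential.hessTimeDelay_symm (h : IsLensPotential ψ) {x : Plane}
    (hx : x ∈ lensPlane ψ) (y v w : Plane) :
    hessTimeDelay ψ y x v w = hessTimeDelay ψ y x w v := by
  have : ContDiffAt ℝ ((⊤ : ℕ∞) : WithTop ℕ∞) (timeDelay ψ y) x := by
    have h1 : ContDiff ℝ ((⊤ : ℕ∞) : WithTop ℕ∞) fun x : Plane => ‖x - y‖ ^ 2 / 2 :=
      ((contDiff_id.sub contDiff_const).norm_sq ℝ).div_const 2
    exact h1.contDiffAt.sub (h.contDiffAt hx)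
  exact (this.isSymmSndFDerivAt (by simp; exact WithTop.coe_le_coe.2 le_top)).eq v w

/-! ### Positive parity as positivity of the Jacobian determinant -/

/-- Entry of the matrix of a linear endomorphism of the plane. -/
def entry (L : Plane →L[ℝ] Plane) (i j : Fin 2) : ℝ := (L (EuclideanSpace.single j 1)) i

theorem det_eq_entry (L : Plane →L[ℝ] Plane) :
    L.det = entry L 0 0 * entry L 1 1 - entry L 0 1 * entry L 1 0 := by
  rw [ContinuousLinearMap.det, ← LinearMap.det_toMatrix (EuclideanSpace.basisFun (Fin 2) ℝ).toBasis,
    Matrix.det_fin_two]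
  simp [entry, LinearMap.toMatrix_apply]

theorem eq_single_add_single (v : Plane) :
    v = v 0 • EuclideanSpace.single 0 1 + v 1 • EuclideanSpace.single 1 1 := by
  ext i; fin_cases i <;> simp

theorem inner_map_self_eq (L : Plane →L[ℝ] Plane) (v : Plane) :
    inner ℝ (L v) v = entry L 0 0 * v 0 ^ 2 + (entry L 0 1 + entry L 1 0) * (v 0 * v 1)
      + entry L 1 1 * v 1 ^ 2 := by
  have h : ∀ i, (L v) i = v 0 * entry L i 0 + v 1 * entry L i 1 := by
    intro i
    conv_lhs => rw [eq_single_add_single v]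
    simp [entry]
  simp only [PiLp.inner_apply, Fin.sum_univ_two, h]
  simp
  ring

theorem coord_ne_zero {v : Plane} (hv : v ≠ 0) : v 0 ≠ 0 ∨ v 1 ≠ 0 := by
  by_contra! hc
  exact hv (by ext i; fin_cases i <;> simp [hc])

theorem quadratic_pos {a b d p q : ℝ} (ha : 0 < a) (hdet : 0 < a * d - b * b)
    (hpq : p ≠ 0 ∨ q ≠ 0) : 0 < a * p ^ 2 + (b + b) * (p * q) + d * q ^ 2 := by
  have h : a * (a * p ^ 2 + (b + b) * (p * q) + d * q ^ 2)
      = (a * p + b * q) ^ 2 + (a * d - b * b) * q ^ 2 := by ring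
  refine pos_of_mul_pos_right (a := a) ?_ ha.le
  rw [h]
  by_cases hq : q = 0
  · have hp : p ≠ 0 := by tauto
    subst hq
    have : 0 < (a * p) ^ 2 := by positivity
    simpa using this
  · have : 0 < (a * d - b * b) * q ^ 2 := by positivity
    positivity

theorem det_pos_of_quadratic_pos {a b d : ℝ}
    (h : ∀ p q : ℝ, (p ≠ 0 ∨ q ≠ 0) → 0 < a * p ^ 2 + (b + b) * (p * q) + d * q ^ 2) :
    0 < a * d - b * b := by
  have ha : 0 < a := by simpa using h 1 0 (by simp)
  -- At `(-b, a)` the form takes the value `a * (a * d - b * b)`.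
  have := h (-b) a (by simp [ha.ne'])
  refine pos_of_mul_pos_right (a := a) ?_ ha.le
  linarith [this]

/-- The sign of the upper left entry decides between the two definite cases, by completing the
square; if that entry is zero, the determinant is minus a square. -/
theorem det_pos_iff_of_symm {L : Plane →L[ℝ] Plane} (hL : entry L 0 1 = entry L 1 0) :
    0 < L.det ↔ (∀ v : Plane, v ≠ 0 → 0 < inner ℝ (L v) v) ∨
      (∀ v : Plane, v ≠ 0 → inner ℝ (L v) v < 0) := by
  have hvec : ∀ p q : ℝ, (p ≠ 0 ∨ q ≠ 0) → (!₂[p, q] : Plane) ≠ 0 := by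
    rintro p q hpq h0
    have h1 := congrArg (fun v : Plane => v 0) h0
    have h2 := congrArg (fun v : Plane => v 1) h0
    simp at h1 h2
    tauto
  simp only [inner_map_self_eq, det_eq_entry, hL]
  constructor
  · intro h
    rcases lt_trichotomy (entry L 0 0) 0 with ha | ha | ha
    · right
      intro v hv
      have := quadratic_pos (a := -entry L 0 0) (b := -entry L 1 0) (d := -entry L 1 1)
        (by linarith) (by linarith) (coord_ne_zero hv)
      linarith
    · rw [ha] at h
      nlinarith [sq_nonneg (entry L 1 0)]
    · left
      intro v hv
      exact quadratic_pos ha h (coord_ne_zero hv)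
  · rintro (h | h)
    · exact det_pos_of_quadratic_pos fun p q hpq => by simpa using h _ (hvec p q hpq)
    · have := det_pos_of_quadratic_pos (a := -entry L 0 0) (b := -entry L 1 0) (d := -entry L 1 1)
        fun p q hpq => by
          have := h _ (hvec p q hpq)
          simp at this
          linarith
      linarith

theorem IsLensPotential.entry_symm (h : IsLensPotential ψ) {x : Plane}
    (hx : x ∈ lensPlane ψ) :
    entry (fderiv ℝ (lensingMap ψ) x) 0 1 = entry (fderiv ℝ (lensingMap ψ) x) 1 0 := by
  have := h.hessTimeDelay_symm hx 0 (EuclideanSpace.single 1 1) (EuclideanSpace.single 0 1)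
  rw [h.hessTimeDelay_eq hx, h.hessTimeDelay_eq hx] at this
  simpa [entry, EuclideanSpace.inner_single_right] using this

/-- The points of `L` at which the Jacobian determinant of the lensing map is positive. -/
def posRegion (ψ : Plane → ℝ) : Set Plane := {x | x ∈ lensPlane ψ ∧ 0 < detJac ψ x}

theorem IsLensPotential.minimum_or_maximum_iff (h : IsLensPotential ψ) (x y : Plane) :
    IsMinimumImage ψ y x ∨ IsMaximumImage ψ y x ↔ x ∈ posRegion ψ ∧ lensingMap ψ x = y := by
  by_cases hx : x ∈ lensPlane ψ
  · have := det_pos_iff_of_symm (h.entry_symm hx)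
    simp only [IsMinimumImage, IsMaximumImage, IsLensedImage, posRegion, Set.mem_ofPred_eq, detJac,
      this, h.hessTimeDelay_eq hx]
    tauto
  · simp [IsMinimumImage, IsMaximumImage, IsLensedImage, posRegion, hx]

theorem not_minimum_and_maximum (x y : Plane) :
    ¬ (IsMinimumImage ψ y x ∧ IsMaximumImage ψ y x) := by
  rintro ⟨h1, h2⟩
  have hv : (EuclideanSpace.single 0 1 : Plane) ≠ 0 := by simp
  exact lt_asymm (h1.2 _ hv) (h2.2 _ hv)

theorem IsLensPotential.numPositiveParity_eq (h : IsLensPotential ψ) (D : Set Plane) (y : Plane) :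
    numPositiveParity ψ D y
      = (({x ∈ D ∩ posRegion ψ | lensingMap ψ x = y}.encard : ℕ∞) : ℝ≥0∞) := by
  rw [numPositiveParity, ← Set.encard_union_eq]
  · congr 2
    ext x
    have := h.minimum_or_maximum_iff x y
    simp only [Set.mem_union, Set.mem_ofPred_eq, Set.mem_inter_iff]
    tauto
  · rw [Set.disjoint_left]
    rintro x ⟨-, h1⟩ ⟨-, h2⟩
    exact not_minimum_and_maximum x y ⟨h1, h2⟩

theorem IsLensPotential.isOpen_posRegion (h : IsLensPotential ψ) : IsOpen (posRegion ψ) := by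
  rw [isOpen_iff_mem_nhds]
  rintro x ⟨hx, hd⟩
  filter_upwards [h.isOpen_lensPlane.mem_nhds hx, (h.continuousAt_detJac hx).eventually_const_lt hd] with z h1 h2
  exact ⟨h1, h2⟩

/-! ### Area formula with multiplicity -/

/-- Area formula with multiplicity for a locally injective differentiable map. -/
theorem lintegral_encard_fiber {E : Type*} [NormedAddCommGroup E] [NormedSpace ℝ E]
    [FiniteDimensional ℝ E] [MeasurableSpace E] [BorelSpace E] (μ : Measure E)
    [μ.IsAddHaarMeasure] {f : E → E} {f' : E → E →L[ℝ] E} {s : Set E} (hs : MeasurableSet s)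
    (hf : ∀ x ∈ s, HasFDerivAt f (f' x) x) (hinj : ∀ x ∈ s, ∃ U ∈ 𝓝 x, Set.InjOn f U) :
    ∫⁻ y, (({x ∈ s | f x = y}.encard : ℕ∞) : ℝ≥0∞) ∂μ = ∫⁻ x in s, ENNReal.ofReal |(f' x).det| ∂μ := by
  rcases s.eq_empty_or_nonempty with rfl | ⟨x₀, hx₀⟩
  · simp
  have hopen : ∀ x, ∃ U : Set E, IsOpen U ∧ (x ∈ s → x ∈ U) ∧ Set.InjOn f U := by
    intro x
    by_cases hx : x ∈ s
    · obtain ⟨U, hU, hi⟩ := hinj x hx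
      obtain ⟨V, hVU, hV, hxV⟩ := mem_nhds_iff.1 hU
      exact ⟨V, hV, fun _ => hxV, hi.mono hVU⟩
    · exact ⟨∅, isOpen_empty, fun h => absurd h hx, Set.injOn_empty f⟩
  choose U hUo hxU hUi using hopen
  obtain ⟨t, -, htc, hst⟩ := TopologicalSpace.countable_cover_nhdsWithin (s := s) (f := U)
    fun x hx => mem_nhdsWithin_of_mem_nhds ((hUo x).mem_nhds (hxU x hx))
  have htne : t.Nonempty := by
    obtain ⟨i, hi, -⟩ := Set.mem_iUnion₂.1 (hst hx₀)
    exact ⟨i, hi⟩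
  obtain ⟨g, rfl⟩ := htc.exists_eq_range htne
  rw [Set.biUnion_range] at hst
  -- Local injectivity and the Lindelöf property cut `s` into countably many disjoint measurable
  -- pieces on which `f` is injective. The multiplicity is then the sum of the indicators of their
  -- images.
  let T : ℕ → Set E := fun n => s ∩ disjointed (fun n => U (g n)) n
  have hTm : ∀ n, MeasurableSet (T n) := fun n =>
    hs.inter (MeasurableSet.disjointed (fun n => (hUo (g n)).measurableSet) n)
  have hTd : Pairwise (Function.onFun Disjoint T) := fun i j hij =>
    ((disjoint_disjointed (fun n => U (g n))) hij).mono Set.inter_subset_right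
      Set.inter_subset_right
  have hTU : ⋃ n, T n = s := by
    simp only [T]
    rw [← Set.inter_iUnion, iUnion_disjointed]
    exact Set.inter_eq_left.2 hst
  have hTi : ∀ n, Set.InjOn f (T n) := fun n =>
    (hUi (g n)).mono (Set.inter_subset_right.trans (disjointed_subset _ n))
  have hTf : ∀ n, ∀ x ∈ T n, HasFDerivWithinAt f (f' x) (T n) x := fun n x hx =>
    (hf x hx.1).hasFDerivWithinAt
  have hcount : ∀ y, (({x ∈ s | f x = y}.encard : ℕ∞) : ℝ≥0∞)
      = ∑' n, (f '' T n).indicator 1 y := by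
    intro y
    have hpiece : ∀ n, (({x ∈ T n | f x = y}.encard : ℕ∞) : ℝ≥0∞)
        = (f '' T n).indicator 1 y := by
      intro n
      by_cases hy : y ∈ f '' T n
      · obtain ⟨x, hx, rfl⟩ := hy
        have : {z ∈ T n | f z = f x} = {x} := by
          ext z
          simp only [Set.mem_ofPred_eq, Set.mem_singleton_iff]
          exact ⟨fun hz => hTi n hz.1 hx hz.2, fun hz => by subst hz; exact ⟨hx, rfl⟩⟩
        rw [this, Set.indicator_of_mem (Set.mem_image_of_mem f hx)]
        simp
      · have : {z ∈ T n | f z = y} = ∅ := by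
          ext z
          simp only [Set.mem_ofPred_eq, Set.mem_empty_iff_false, iff_false]
          exact fun hz => hy ⟨z, hz⟩
        rw [this, Set.indicator_of_notMem hy]
        simp
    have hunion : {x ∈ s | f x = y} = ⋃ n, {x ∈ T n | f x = y} := by
      rw [← hTU]
      ext z
      simp
    -- With every set measurable, countable additivity of counting measure is additivity of
    -- `encard`.
    let _ : MeasurableSpace E := ⊤
    have := measure_iUnion (μ := (Measure.count : Measure E))
      (f := fun n => {x ∈ T n | f x = y})
      (fun i j hij => (hTd hij).mono (fun _ h => h.1) fun _ h => h.1)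
      (fun _ => MeasurableSpace.measurableSet_top)
    simp only [← hpiece, ← Measure.count_apply MeasurableSpace.measurableSet_top]
    rw [hunion, this]
  simp only [hcount]
  have hTfm : ∀ n, MeasurableSet (f '' T n) := fun n =>
    measurable_image_of_fderivWithin (hTm n) (hTf n) (hTi n)
  rw [lintegral_tsum fun n => (measurable_one.indicator (hTfm n)).aemeasurable]
  simp only [lintegral_indicator_one (hTfm _)]
  conv_rhs => rw [← hTU, lintegral_iUnion hTm hTd]
  exact tsum_congr fun n =>
    (lintegral_abs_det_fderiv_eq_addHaar_image μ (hTm n) (hTf n) (hTi n)).symm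

theorem IsLensPotential.exists_injOn_nhds (h : IsLensPotential ψ) {x : Plane}
    (hx : x ∈ posRegion ψ) : ∃ U ∈ 𝓝 x, Set.InjOn (lensingMap ψ) U := by
  have hs : HasStrictFDerivAt (lensingMap ψ) (fderiv ℝ (lensingMap ψ) x) x :=
    (h.contDiffAt_lensingMap hx.1).hasStrictFDerivAt (by simp)
  have hdet : (fderiv ℝ (lensingMap ψ) x).det ≠ 0 := hx.2.ne'
  let e := (fderiv ℝ (lensingMap ψ) x).toContinuousLinearEquivOfDetNeZero hdet
  have hs' : HasStrictFDerivAt (lensingMap ψ) (e : Plane →L[ℝ] Plane) x := hs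
  refine ⟨(hs'.toOpenPartialHomeomorph _).source,
    (hs'.toOpenPartialHomeomorph _).open_source.mem_nhds
      hs'.mem_toOpenPartialHomeomorph_source, ?_⟩
  have := (hs'.toOpenPartialHomeomorph _).injOn
  rwa [hs'.toOpenPartialHomeomorph_coe] at this

theorem IsLensPotential.lintegral_numPositiveParity (h : IsLensPotential ψ) {D : Set Plane}
    (hD : MeasurableSet D) :
    ∫⁻ y, numPositiveParity ψ D y = ∫⁻ x in D, posDetJac ψ x := by
  have hU := h.isOpen_posRegion.measurableSet
  simp only [h.numPositiveParity_eq]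
  rw [lintegral_encard_fiber volume (hD.inter hU)
    (fun x hx => (h.differentiableAt_lensingMap hx.2.1).hasFDerivAt)
    (fun x hx => h.exists_injOn_nhds hx.2)]
  change _ = ∫⁻ x in D, (posRegion ψ).indicator (fun z => ENNReal.ofReal (detJac ψ z)) x
  rw [setLIntegral_indicator hU, Set.inter_comm]
  refine setLIntegral_congr_fun (hU.inter hD) fun x hx => ?_
  change ENNReal.ofReal |detJac ψ x| = _
  rw [abs_of_pos hx.1.2]

/-! ### Jointly measurable versions of the derivatives -/

/-- Limit of the forward difference quotients along `1 / (k + 1)`. -/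
def seqDeriv (v : Plane) (f : Plane → ℝ) (x : Plane) : ℝ :=
  limsup (fun k : ℕ => ((k : ℝ) + 1) * (f (x + ((k : ℝ) + 1)⁻¹ • v) - f x)) atTop

theorem seqDeriv_eq {f u : Plane → ℝ} {U : Set Plane} (hU : IsOpen U) (hfu : Set.EqOn f u U)
    {x : Plane} (hx : x ∈ U) (hu : DifferentiableAt ℝ u x) (v : Plane) :
    seqDeriv v f x = fderiv ℝ u x v := by
  have hc : Tendsto (fun k : ℕ => ‖(k : ℝ) + 1‖) atTop atTop :=
    tendsto_norm_atTop_atTop.comp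
      (tendsto_atTop_add_const_right _ _ tendsto_natCast_atTop_atTop)
  have hlim := hu.hasFDerivAt.lim v hc
  have hf : HasFDerivAt f (fderiv ℝ u x) x :=
    hu.hasFDerivAt.congr_of_eventuallyEq (hfu.eventuallyEq_of_mem (hU.mem_nhds hx))
  exact (hf.lim v hc).limsup_eq

theorem measurable_seqDeriv {Ω : Type*} [MeasurableSpace Ω] {f : Ω → Plane → ℝ}
    (hf : Measurable fun p : Ω × Plane => f p.1 p.2) (v : Plane) :
    Measurable fun p : Ω × Plane => seqDeriv v (f p.1) p.2 := by
  refine Measurable.limsup fun k => ?_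
  have h : Measurable fun p : Ω × Plane => (p.1, p.2 + ((k : ℝ) + 1)⁻¹ • v) := by fun_prop
  exact ((hf.comp h).sub hf).const_mul _

/-- Limit of the values of `f` at simple approximations of the identity. -/
def simpleLimit (f : Plane → ℝ) (x : Plane) : ℝ :=
  limsup (fun n : ℕ => f ((stronglyMeasurable_id (α := Plane)).approx n x)) atTop

theorem simpleLimit_eq {f : Plane → ℝ} {x : Plane} (hf : ContinuousAt f x) :
    simpleLimit f x = f x :=
  (hf.tendsto.comp (stronglyMeasurable_id.tendsto_approx x)).limsup_eq

/-- Each simple approximation takes finitely many values, so only countably many fixed points `x`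
enter, and measurability in `ω` at fixed points suffices. -/
theorem measurable_simpleLimit {Ω : Type*} [MeasurableSpace Ω] {f : Ω → Plane → ℝ}
    (hf : ∀ x, Measurable fun ω => f ω x) :
    Measurable fun p : Ω × Plane => simpleLimit (f p.1) p.2 := by
  refine Measurable.limsup fun n => ?_
  let s := (stronglyMeasurable_id (α := Plane)).approx n
  have h1 : Measurable fun p : Ω × s.range => f p.1 p.2 :=
    measurable_from_prod_countable_left fun j => hf j
  have h2 : Measurable fun p : Ω × Plane => (p.1, (⟨s p.2, s.mem_range_self _⟩ : s.range)) :=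
    measurable_fst.prodMk ((s.measurable.comp measurable_snd).subtype_mk)
  exact h1.comp h2

/-- Jointly measurable version of a component of the lensing map. -/
def lensApprox (ψ : Plane → ℝ) (i : Fin 2) (x : Plane) : ℝ :=
  x i - seqDeriv (EuclideanSpace.single i 1) (simpleLimit ψ) x

/-- Jointly measurable version of an entry of the Jacobian matrix of the lensing map. -/
def jacApprox (ψ : Plane → ℝ) (i j : Fin 2) : Plane → ℝ :=
  seqDeriv (EuclideanSpace.single j 1) (lensApprox ψ i)

/-- Jointly measurable version of the Jacobian determinant of the lensing map. -/
def detApprox (ψ : Plane → ℝ) (x : Plane) : ℝ :=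
  jacApprox ψ 0 0 x * jacApprox ψ 1 1 x - jacApprox ψ 0 1 x * jacApprox ψ 1 0 x

/-- Jointly measurable version of the Laplacian of the potential. -/
def lapApprox (ψ : Plane → ℝ) (x : Plane) : ℝ := 2 - jacApprox ψ 0 0 x - jacApprox ψ 1 1 x

section Measurability

variable {Ω : Type*} [MeasurableSpace Ω] {Ψ : Ω → Plane → ℝ}

theorem measurable_lensApprox (hΨ : ∀ x, Measurable fun ω => Ψ ω x) (i : Fin 2) :
    Measurable fun p : Ω × Plane => lensApprox (Ψ p.1) i p.2 := by
  have h : Measurable fun p : Ω × Plane => p.2 i := by fun_prop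
  exact h.sub (measurable_seqDeriv (f := fun ω => simpleLimit (Ψ ω)) (measurable_simpleLimit hΨ) _)

theorem measurable_jacApprox (hΨ : ∀ x, Measurable fun ω => Ψ ω x) (i j : Fin 2) :
    Measurable fun p : Ω × Plane => jacApprox (Ψ p.1) i j p.2 :=
  measurable_seqDeriv (f := fun ω => lensApprox (Ψ ω) i) (measurable_lensApprox hΨ i) _

theorem measurable_detApprox (hΨ : ∀ x, Measurable fun ω => Ψ ω x) :
    Measurable fun p : Ω × Plane => detApprox (Ψ p.1) p.2 :=
  ((measurable_jacApprox hΨ 0 0).mul (measurable_jacApprox hΨ 1 1)).sub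
    ((measurable_jacApprox hΨ 0 1).mul (measurable_jacApprox hΨ 1 0))

theorem measurable_lapApprox (hΨ : ∀ x, Measurable fun ω => Ψ ω x) :
    Measurable fun p : Ω × Plane => lapApprox (Ψ p.1) p.2 :=
  ((measurable_jacApprox hΨ 0 0).const_sub 2).sub (measurable_jacApprox hΨ 1 1)

end Measurability

theorem lensingMap_apply (x : Plane) (i : Fin 2) :
    lensingMap ψ x i = x i - fderiv ℝ ψ x (EuclideanSpace.single i 1) := by
  have : gradient ψ x i = fderiv ℝ ψ x (EuclideanSpace.single i 1) := by
    rw [← inner_gradient, EuclideanSpace.inner_single_right]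
    simp
  simp [lensingMap, this]

theorem IsLensPotential.lensApprox_eq (h : IsLensPotential ψ) {x : Plane}
    (hx : x ∈ lensPlane ψ) (i : Fin 2) : lensApprox ψ i x = lensingMap ψ x i := by
  rw [lensApprox, lensingMap_apply, seqDeriv_eq h.isOpen_lensPlane
    (fun z hz => simpleLimit_eq (h.contDiffAt hz).continuousAt) hx
    ((h.contDiffAt hx).differentiableAt (by simp))]

theorem hasFDerivAt_coord {f : Plane → Plane} {f' : Plane →L[ℝ] Plane} {x : Plane}
    (hf : HasFDerivAt f f' x) (i : Fin 2) :
    HasFDerivAt (fun z => f z i) ((EuclideanSpace.proj i : Plane →L[ℝ] ℝ).comp f') x :=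
  (EuclideanSpace.proj i : Plane →L[ℝ] ℝ).hasFDerivAt.comp x hf

theorem IsLensPotential.jacApprox_eq (h : IsLensPotential ψ) {x : Plane}
    (hx : x ∈ lensPlane ψ) (i j : Fin 2) :
    jacApprox ψ i j x = entry (fderiv ℝ (lensingMap ψ) x) i j := by
  have hd := hasFDerivAt_coord (h.differentiableAt_lensingMap hx).hasFDerivAt i
  rw [jacApprox, seqDeriv_eq h.isOpen_lensPlane (fun z hz => h.lensApprox_eq hz i) hx
    hd.differentiableAt, hd.fderiv]
  rfl

theorem IsLensPotential.detApprox_eq (h : IsLensPotential ψ) {x : Plane}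
    (hx : x ∈ lensPlane ψ) : detApprox ψ x = detJac ψ x := by
  simp only [detApprox, h.jacApprox_eq hx, detJac, det_eq_entry]

/-- Trace of `Jac η = I - Hess ψ`. This is what makes the Laplacian, which enters the definition of
a singularity, accessible through `jacApprox`. -/
theorem IsLensPotential.laplacian_eq (h : IsLensPotential ψ) {x : Plane}
    (hx : x ∈ lensPlane ψ) :
    Laplacian.laplacian ψ x = 2 - entry (fderiv ℝ (lensingMap ψ) x) 0 0
      - entry (fderiv ℝ (lensingMap ψ) x) 1 1 := by
  have hdiag : ∀ i, entry (fderiv ℝ (lensingMap ψ) x) i i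
      = 1 - fderiv ℝ (fderiv ℝ ψ) x (EuclideanSpace.single i 1) (EuclideanSpace.single i 1) := by
    intro i
    have hd := hasFDerivAt_coord (h.differentiableAt_lensingMap hx).hasFDerivAt i
    have h1 := hasFDerivAt_coord (hasFDerivAt_id x) i
    have h2 := ((h.contDiffAt_fderiv hx).differentiableAt (by simp)).hasFDerivAt.clm_apply
      (hasFDerivAt_const (EuclideanSpace.single i 1 : Plane) x)
    have h3 := h1.sub h2
    have h4 : (fun z => lensingMap ψ z i)
        = fun z : Plane => z i - fderiv ℝ ψ z (EuclideanSpace.single i 1) :=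
      funext fun z => lensingMap_apply z i
    rw [h4] at hd
    have := congrArg (fun T : Plane →L[ℝ] ℝ => T (EuclideanSpace.single i 1)) (hd.unique h3)
    simpa [entry] using this
  rw [InnerProductSpace.laplacian_eq_iteratedFDeriv_orthonormalBasis ψ
    (EuclideanSpace.basisFun (Fin 2) ℝ), hdiag, hdiag]
  simp [iteratedFDeriv_two_apply]
  ring

theorem IsLensPotential.lapApprox_eq (h : IsLensPotential ψ) {x : Plane}
    (hx : x ∈ lensPlane ψ) : lapApprox ψ x = Laplacian.laplacian ψ x := by
  rw [lapApprox, h.laplacian_eq hx, h.jacApprox_eq hx, h.jacApprox_eq hx]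

theorem continuous_entry (i j : Fin 2) : Continuous fun L : Plane →L[ℝ] Plane => entry L i j := by
  unfold entry
  fun_prop

theorem IsLensPotential.continuousAt_laplacian (h : IsLensPotential ψ) {x : Plane}
    (hx : x ∈ lensPlane ψ) : ContinuousAt (Laplacian.laplacian ψ) x := by
  have hJ : ContinuousAt (fderiv ℝ (lensingMap ψ)) x :=
    ((h.contDiffAt_lensingMap hx).fderiv_right (m := 0) (by simp)).continuousAt
  have hE : ∀ i j, ContinuousAt (fun z => entry (fderiv ℝ (lensingMap ψ) z) i j) x := fun i j =>
    (continuous_entry i j).continuousAt.comp hJ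
  refine (((continuousAt_const (y := (2 : ℝ))).sub (hE 0 0)).sub (hE 1 1)).congr ?_
  filter_upwards [h.isOpen_lensPlane.mem_nhds hx] with z hz
  exact (h.laplacian_eq hz).symm

/-! ### The lens plane and the images seen from a dense sequence -/

/-- A fixed dense sequence of the plane. -/
def densePt : ℕ → Plane := TopologicalSpace.denseSeq Plane

theorem exists_densePt_of_eventually {x : Plane} {p : Plane → Prop} (hp : ∀ᶠ z in 𝓝 x, p z) :
    ∃ k, p (densePt k) := by
  obtain ⟨U, hU, hUo, hx⟩ := mem_nhds_iff.1 hp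
  obtain ⟨k, hk⟩ := (TopologicalSpace.denseRange_denseSeq Plane).exists_mem_open hUo ⟨x, hx⟩
  exact ⟨k, hU hk⟩

theorem exists_densePt_of_eventually_ne {x : Plane} {p : Plane → Prop}
    (hp : ∀ᶠ z in 𝓝[≠] x, p z) : ∃ k, p (densePt k) := by
  -- The point `x` may itself belong to the sequence, so the search moves to a nearby `z ≠ x`, where
  -- `p` holds on a full neighbourhood.
  obtain ⟨z, hz, hzx⟩ := ((eventually_eventually_nhdsWithin.2 hp).and
    (self_mem_nhdsWithin (a := x))).exists
  rw [isOpen_compl_singleton.nhdsWithin_eq hzx] at hz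
  exact exists_densePt_of_eventually hz

/-- Points near which the potential and its Laplacian are bounded by `m` on a dense sequence. -/
def boundedRegion (ψ : Plane → ℝ) (m : ℕ) : Set Plane :=
  {x | ∀ k, dist (densePt k) x < 1 / ((m : ℝ) + 1) →
    |simpleLimit ψ (densePt k)| ≤ m ∧ |lapApprox ψ (densePt k)| ≤ m}

theorem isClosed_boundedRegion (ψ : Plane → ℝ) (m : ℕ) : IsClosed (boundedRegion ψ m) := by
  have : boundedRegion ψ m = ⋂ k, {x | dist (densePt k) x < 1 / ((m : ℝ) + 1) →
      |simpleLimit ψ (densePt k)| ≤ m ∧ |lapApprox ψ (densePt k)| ≤ m} := by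
    ext x
    simp [boundedRegion]
  rw [this]
  refine isClosed_iInter fun k => isClosed_imp (isOpen_lt (by fun_prop) continuous_const)
    isClosed_const

theorem eventually_mem_boundedRegion {m n : ℕ} (hmn : m < n) {x : Plane}
    (hx : x ∈ boundedRegion ψ m) : ∀ᶠ z in 𝓝 x, z ∈ boundedRegion ψ n := by
  have h1 : (1 : ℝ) / (n + 1) < 1 / (m + 1) :=
    Nat.one_div_lt_one_div hmn
  have h2 : (m : ℝ) ≤ n := by exact_mod_cast hmn.le
  filter_upwards [Metric.ball_mem_nhds x (sub_pos.2 h1)] with z hz k hk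
  have := hx k (by linarith [dist_triangle (densePt k) z x, Metric.mem_ball.1 hz])
  exact ⟨this.1.trans h2, this.2.trans h2⟩

/-- On `L` both `ψ` and its Laplacian are continuous, hence locally bounded. At a singularity one of
them is unbounded, and the dense sequence detects this because nearby points other than the
singularity lie in `L`, where the approximations are exact. -/
theorem IsLensPotential.mem_lensPlane_iff (h : IsLensPotential ψ) {x : Plane} :
    x ∈ lensPlane ψ ↔ ∃ m, x ∈ boundedRegion ψ m := by
  constructor
  · intro hx
    have e1 : ∀ᶠ z in 𝓝 x, |ψ z| < |ψ x| + 1 :=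
      (h.contDiffAt hx).continuousAt.abs.eventually_lt_const (by linarith)
    have e2 : ∀ᶠ z in 𝓝 x, |Laplacian.laplacian ψ z| < |Laplacian.laplacian ψ x| + 1 :=
      (h.continuousAt_laplacian hx).abs.eventually_lt_const (by linarith)
    obtain ⟨δ, hδ, hball⟩ := Metric.eventually_nhds_iff.1
      ((e1.and e2).and (h.isOpen_lensPlane.mem_nhds hx))
    obtain ⟨m1, hm1⟩ := exists_nat_one_div_lt hδ
    obtain ⟨m2, hm2⟩ := exists_nat_ge (|ψ x| + 1)
    obtain ⟨m3, hm3⟩ := exists_nat_ge (|Laplacian.laplacian ψ x| + 1)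
    refine ⟨m1 + m2 + m3, fun k hk => ?_⟩
    have hk' : dist (densePt k) x < δ := by
      refine (hk.trans_le ?_).trans hm1
      push_cast
      gcongr
      linarith [Nat.cast_nonneg (α := ℝ) m2, Nat.cast_nonneg (α := ℝ) m3]
    obtain ⟨⟨b1, b2⟩, hL⟩ := hball hk'
    rw [simpleLimit_eq (h.contDiffAt hL).continuousAt, h.lapApprox_eq hL]
    push_cast
    have := Nat.cast_nonneg (α := ℝ) m1
    have := Nat.cast_nonneg (α := ℝ) m2
    have := Nat.cast_nonneg (α := ℝ) m3
    constructor <;> linarith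
  · rintro ⟨m, hm⟩ hx
    have hL : ∀ᶠ z in 𝓝[≠] x, z ∈ lensPlane ψ := by
      have : (singularSet ψ \ {x})ᶜ ∈ 𝓝 x :=
        (h.finite_singularSet.subset Set.sdiff_subset).isClosed.isOpen_compl.mem_nhds (by simp)
      filter_upwards [mem_nhdsWithin_of_mem_nhds this, self_mem_nhdsWithin] with z h1 h2 h3
      exact h1 ⟨h3, h2⟩
    have hB : ∀ᶠ z in 𝓝[≠] x, dist z x < 1 / ((m : ℝ) + 1) :=
      mem_nhdsWithin_of_mem_nhds (Metric.ball_mem_nhds x (by positivity))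
    rcases hx with hx | hx
    · obtain ⟨k, ⟨k1, k2⟩, k3⟩ := exists_densePt_of_eventually_ne
        ((hL.and hB).and (hx.eventually_lt_atBot (-(m : ℝ))))
      have := (hm k k2).1
      rw [simpleLimit_eq (h.contDiffAt k1).continuousAt] at this
      linarith [neg_abs_le (ψ (densePt k))]
    · obtain ⟨k, ⟨k1, k2⟩, k3⟩ := exists_densePt_of_eventually_ne
        ((hL.and hB).and (hx.eventually_gt_atTop (m : ℝ)))
      have := (hm k k2).2
      rw [h.lapApprox_eq k1] at this
      linarith [le_abs_self (Laplacian.laplacian ψ (densePt k))]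

/-- A compactness argument. Fixing `m` before `j` keeps the approximate images uniformly away from
singularities and from `det = 0`; both conditions are closed, so a limit point in `K` is still a
genuine image in `posRegion`. -/
theorem IsLensPotential.exists_image_iff (h : IsLensPotential ψ) {K : Set Plane}
    (hK : IsCompact K) (y : Plane) :
    (∃ x ∈ K, x ∈ posRegion ψ ∧ lensingMap ψ x = y) ↔
      ∃ m : ℕ, ∀ j : ℕ, ∃ k : ℕ, densePt k ∈ boundedRegion ψ m ∧
        1 / ((m : ℝ) + 1) ≤ detApprox ψ (densePt k) ∧
        densePt k ∈ Metric.thickening (1 / ((j : ℝ) + 1)) K ∧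
        ∀ i, |lensApprox ψ i (densePt k) - y i| < 1 / ((j : ℝ) + 1) := by
  constructor
  · rintro ⟨x, hxK, ⟨hxL, hdet⟩, rfl⟩
    obtain ⟨m₀, hm₀⟩ := h.mem_lensPlane_iff.1 hxL
    obtain ⟨m₁, hm₁⟩ := exists_nat_one_div_lt hdet
    -- The extra `1` makes the index exceed `m₀`, so that a whole neighbourhood of `x` lies in the
    -- bounded region; `m₁` serves the determinant bound.
    refine ⟨m₀ + 1 + m₁, fun j => ?_⟩
    have hj : (0 : ℝ) < 1 / ((j : ℝ) + 1) := by positivity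
    have hm : 1 / (((m₀ + 1 + m₁ : ℕ) : ℝ) + 1) < detJac ψ x := by
      refine lt_of_le_of_lt ?_ hm₁
      push_cast
      gcongr
      linarith [Nat.cast_nonneg (α := ℝ) m₀]
    have e4 : ∀ᶠ z in 𝓝 x, ∀ i, |lensingMap ψ z i - lensingMap ψ x i| < 1 / ((j : ℝ) + 1) := by
      refine eventually_all.2 fun i => ?_
      have : ContinuousAt (fun z => |lensingMap ψ z i - lensingMap ψ x i|) x :=
        (((hasFDerivAt_coord (h.differentiableAt_lensingMap hxL).hasFDerivAt i).continuousAt).sub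
          continuousAt_const).abs
      exact this.eventually_lt_const (by simpa using hj)
    have e : ∀ᶠ z in 𝓝 x, z ∈ boundedRegion ψ (m₀ + 1 + m₁) ∧
        1 / (((m₀ + 1 + m₁ : ℕ) : ℝ) + 1) ≤ detApprox ψ z ∧
        z ∈ Metric.thickening (1 / ((j : ℝ) + 1)) K ∧
        ∀ i, |lensApprox ψ i z - lensingMap ψ x i| < 1 / ((j : ℝ) + 1) := by
      filter_upwards [eventually_mem_boundedRegion (n := m₀ + 1 + m₁) (by omega) hm₀,
        (h.continuousAt_detJac hxL).eventually_const_lt hm,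
        Metric.isOpen_thickening.mem_nhds (Metric.self_subset_thickening hj K hxK), e4,
        h.isOpen_lensPlane.mem_nhds hxL] with z h1 h2 h3 h4 h5
      exact ⟨h1, (h.detApprox_eq h5).symm ▸ h2.le, h3,
        fun i => (h.lensApprox_eq h5 i).symm ▸ h4 i⟩
    obtain ⟨k, hk⟩ := exists_densePt_of_eventually e
    exact ⟨k, hk⟩
  · rintro ⟨m, hm⟩
    choose k hkB hkd hkK hky using hm
    simp only [Metric.mem_thickening_iff] at hkK
    choose z hzK hz using hkK
    obtain ⟨x, hxK, φ, hφ, hlim⟩ := hK.tendsto_subseq hzK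
    have hlim0 : Tendsto (fun j => 1 / (((φ j : ℕ) : ℝ) + 1)) atTop (𝓝 0) :=
      tendsto_one_div_add_atTop_nhds_zero_nat.comp hφ.tendsto_atTop
    have hdist : Tendsto (fun j => dist (densePt (k (φ j))) (z (φ j))) atTop (𝓝 0) :=
      squeeze_zero (fun _ => dist_nonneg) (fun j => (hz (φ j)).le) hlim0
    have hq : Tendsto (fun j => densePt (k (φ j))) atTop (𝓝 x) :=
      (tendsto_iff_of_dist hdist).2 hlim
    have hxL : x ∈ lensPlane ψ := h.mem_lensPlane_iff.2
      ⟨m, (isClosed_boundedRegion ψ m).mem_of_tendsto hq (Eventually.of_forall fun j => hkB _)⟩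
    have hqL : ∀ j, densePt (k j) ∈ lensPlane ψ := fun j => h.mem_lensPlane_iff.2 ⟨m, hkB j⟩
    have hdet : 1 / ((m : ℝ) + 1) ≤ detJac ψ x := by
      refine ge_of_tendsto' ((h.continuousAt_detJac hxL).tendsto.comp hq) fun j => ?_
      simpa only [Function.comp_apply, ← h.detApprox_eq (hqL (φ j))] using hkd (φ j)
    refine ⟨x, hxK, ⟨hxL, lt_of_lt_of_le (by positivity) hdet⟩, ?_⟩
    ext i
    have hc := (hasFDerivAt_coord (h.differentiableAt_lensingMap hxL).hasFDerivAt i).continuousAt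
    have h1 : Tendsto (fun j => |lensingMap ψ (densePt (k (φ j))) i - y i|) atTop
        (𝓝 |lensingMap ψ x i - y i|) := ((hc.tendsto.comp hq).sub_const (y i)).abs
    have h2 : Tendsto (fun j => |lensingMap ψ (densePt (k (φ j))) i - y i|) atTop (𝓝 0) := by
      refine squeeze_zero (fun _ => abs_nonneg _) (fun j => ?_) hlim0
      rw [← h.lensApprox_eq (hqL (φ j))]
      exact (hky (φ j) i).le
    exact sub_eq_zero.1 (abs_eq_zero.1 (tendsto_nhds_unique h1 h2))

/-! ### Counting points by disjoint balls -/

/-- Closed balls with dense centres and arbitrarily small radii. -/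
def smallBall (b : ℕ × ℕ) : Set Plane := Metric.closedBall (densePt b.1) (1 / ((b.2 : ℝ) + 1))

open Classical in
-- Disjoint balls that meet `S` contain distinct points of `S`; conversely, finitely many points of
-- `S` can be separated by small balls. The index set is countable, as measurability requires.
theorem encard_eq_iSup_smallBall (S : Set Plane) :
    ((S.encard : ℕ∞) : ℝ≥0∞) =
      ⨆ F : {F : Finset (ℕ × ℕ) // (F : Set (ℕ × ℕ)).PairwiseDisjoint smallBall},
        ∑ b ∈ F.1, if ∃ x ∈ smallBall b, x ∈ S then 1 else 0 := by
  apply le_antisymm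
  · have key : ∀ T : Finset Plane, (T : Set Plane) ⊆ S → (T.card : ℝ≥0∞) ≤
        ⨆ F : {F : Finset (ℕ × ℕ) // (F : Set (ℕ × ℕ)).PairwiseDisjoint smallBall},
          ∑ b ∈ F.1, if ∃ x ∈ smallBall b, x ∈ S then 1 else 0 := by
      intro T hT
      -- If two of the balls met, their points would be at most four radii apart: point to centre,
      -- centre to common point, and back.
      have hsep : ∀ᶠ n : ℕ in atTop, ∀ x ∈ T, ∀ x' ∈ T, x ≠ x' →
          4 * (1 / ((n : ℝ) + 1)) < dist x x' := by
        rw [eventually_all_finset]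
        intro x _
        rw [eventually_all_finset]
        intro x' _
        by_cases hxx : x = x'
        · simp [hxx]
        · have := (tendsto_one_div_add_atTop_nhds_zero_nat (𝕜 := ℝ)).const_mul 4
          rw [mul_zero] at this
          filter_upwards [this.eventually_lt_const (dist_pos.2 hxx)] with n hn _ using hn
      obtain ⟨n, hn⟩ := hsep.exists
      have hpos : (0 : ℝ) < 1 / ((n : ℝ) + 1) := by positivity
      have hk : ∀ x : Plane, ∃ k, dist (densePt k) x < 1 / ((n : ℝ) + 1) := fun x =>
        exists_densePt_of_eventually (Metric.ball_mem_nhds x hpos)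
      choose k hk using hk
      have hinj : Set.InjOn (fun x => (k x, n)) (T : Set Plane) := by
        intro x hx x' hx' he
        by_contra hne
        have h1 := hk x
        have h2 := hk x'
        rw [← (Prod.mk.inj he).1] at h2
        linarith [hn x hx x' hx' hne, dist_triangle_left x x' (densePt (k x))]
      have hdisj : ((T.image fun x => (k x, n) : Finset (ℕ × ℕ)) :
          Set (ℕ × ℕ)).PairwiseDisjoint smallBall := by
        rw [Finset.coe_image, Set.InjOn.pairwiseDisjoint_image hinj]
        intro x hx x' hx' hne
        refine Set.disjoint_left.2 fun w hw hw' => ?_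
        simp only [Function.comp_apply, smallBall, Metric.mem_closedBall] at hw hw'
        linarith [hn x hx x' hx' hne, dist_triangle_left x x' (densePt (k x)), hk x, hk x',
          dist_triangle (densePt (k x)) w x', dist_triangle w (densePt (k x')) x',
          dist_comm w (densePt (k x))]
      refine le_trans ?_ (le_iSup _ ⟨_, hdisj⟩)
      simp only
      rw [Finset.sum_image hinj]
      rw [Finset.sum_congr rfl (g := fun _ => (1 : ℝ≥0∞))]
      · simp
      · intro x hx
        rw [if_pos]
        refine ⟨x, ?_, hT hx⟩
        rw [smallBall, Metric.mem_closedBall, dist_comm]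
        exact (hk x).le
    by_cases hS : S.Finite
    · have := key hS.toFinset (by simp)
      rw [hS.encard_eq_coe_toFinset_card]
      simpa using this
    · refine ENNReal.le_of_forall_nnreal_lt fun r _ => ?_
      obtain ⟨n, hn⟩ := exists_nat_ge r
      obtain ⟨T, hTS, hTn⟩ := Set.Infinite.exists_subset_card_eq hS n
      have := key T hTS
      rw [hTn] at this
      exact le_trans (by exact_mod_cast hn) this
  · refine iSup_le fun ⟨F, hF⟩ => ?_
    simp only
    rw [← Finset.sum_filter, Finset.sum_const, nsmul_one]
    have hex : ∀ b : ℕ × ℕ, ∃ x, (∃ x ∈ smallBall b, x ∈ S) → x ∈ smallBall b ∧ x ∈ S := by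
      intro b
      by_cases hb : ∃ x ∈ smallBall b, x ∈ S
      · obtain ⟨x, hx⟩ := hb
        exact ⟨x, fun _ => hx⟩
      · exact ⟨0, fun h => absurd h hb⟩
    choose g hg using hex
    set F' := F.filter fun b => ∃ x ∈ smallBall b, x ∈ S with hF'
    have hle : (F' : Set (ℕ × ℕ)).encard ≤ S.encard := by
      refine Set.encard_le_encard_of_injOn (f := g) ?_ ?_
      · intro b hb
        exact (hg b (Finset.mem_filter.1 hb).2).2
      · intro b hb b' hb' he
        by_contra hne
        have hb := Finset.mem_filter.1 hb
        have hb' := Finset.mem_filter.1 hb'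
        refine Set.disjoint_left.1 (hF hb.1 hb'.1 hne) (hg b hb.2).1 ?_
        rw [he]
        exact (hg b' hb'.2).1
    rw [Set.encard_coe_eq_coe_finsetCard] at hle
    exact_mod_cast (ENat.toENNReal_le.2 hle)

/-! ### Joint measurability and Tonelli -/

section JointMeasurability

attribute [local irreducible] lensApprox detApprox

variable {Ω : Type*} [MeasurableSpace Ω] {Ψ : Ω → Plane → ℝ}

theorem measurableSet_boundedRegion (hΨ : ∀ x, Measurable fun ω => Ψ ω x) (m : ℕ) :
    MeasurableSet {p : Ω × Plane | p.2 ∈ boundedRegion (Ψ p.1) m} := by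
  refine measurableSet_setOfPred.2 (Measurable.forall fun k => Measurable.imp ?_ ?_)
  · exact measurableSet_setOfPred.1 (measurableSet_lt (by fun_prop) measurable_const)
  · have hk : Measurable fun p : Ω × Plane => (p.1, densePt k) := by fun_prop
    have h1 : Measurable fun p : Ω × Plane => |simpleLimit (Ψ p.1) (densePt k)| :=
      ((measurable_simpleLimit hΨ).comp hk).abs
    have h2 : Measurable fun p : Ω × Plane => |lapApprox (Ψ p.1) (densePt k)| :=
      ((measurable_lapApprox hΨ).comp hk).abs
    exact (measurableSet_setOfPred.1 (measurableSet_le h1 measurable_const)).and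
      (measurableSet_setOfPred.1 (measurableSet_le h2 measurable_const))

theorem measurableSet_exists_image (hΨ : ∀ x, Measurable fun ω => Ψ ω x) (K : Set Plane) :
    MeasurableSet {p : Ω × Plane | ∃ m : ℕ, ∀ j : ℕ, ∃ k : ℕ,
      densePt k ∈ boundedRegion (Ψ p.1) m ∧
      1 / ((m : ℝ) + 1) ≤ detApprox (Ψ p.1) (densePt k) ∧
      densePt k ∈ Metric.thickening (1 / ((j : ℝ) + 1)) K ∧
      ∀ i, |lensApprox (Ψ p.1) i (densePt k) - p.2 i| < 1 / ((j : ℝ) + 1)} := by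
  refine measurableSet_setOfPred.2 (Measurable.exists fun m => Measurable.forall fun j =>
    Measurable.exists fun k => ?_)
  have hk : Measurable fun p : Ω × Plane => (p.1, densePt k) := by fun_prop
  have h1 : MeasurableSet {p : Ω × Plane | densePt k ∈ boundedRegion (Ψ p.1) m} :=
    hk (measurableSet_boundedRegion hΨ m)
  have h2 : Measurable fun p : Ω × Plane => detApprox (Ψ p.1) (densePt k) :=
    (measurable_detApprox hΨ).comp hk
  have h3 : ∀ i, Measurable fun p : Ω × Plane =>
      |lensApprox (Ψ p.1) i (densePt k) - p.2 i| := by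
    intro i
    have h4 : Measurable fun p : Ω × Plane => lensApprox (Ψ p.1) i (densePt k) :=
      (measurable_lensApprox hΨ i).comp hk
    have h5 : Measurable fun p : Ω × Plane => p.2 i := by fun_prop
    exact (h4.sub h5).abs
  exact (measurableSet_setOfPred.1 h1).and
    ((measurableSet_setOfPred.1 (measurableSet_le measurable_const h2)).and
      (measurable_const.and (Measurable.forall fun i =>
        measurableSet_setOfPred.1 (measurableSet_lt (h3 i) measurable_const))))

variable {P : Measure Ω}

theorem IsRandomLensPotential.ae_prod (hψ : IsRandomLensPotential P Ψ) :
    ∀ᵐ p : Ω × Plane ∂P.prod volume, IsLensPotential (Ψ p.1) :=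
  Measure.quasiMeasurePreserving_fst.ae hψ.ae_isLensPotential

/-- Compactness of `D` makes each `smallBall b ∩ D` compact, so whether it contains an image is a
countable condition. The formula is exact for lens potentials only, hence measurability up to a null
set. -/
theorem IsRandomLensPotential.aemeasurable_numPositiveParity (hψ : IsRandomLensPotential P Ψ)
    {D : Set Plane} (hD : IsCompact D) :
    AEMeasurable (fun p : Ω × Plane => numPositiveParity (Ψ p.1) D p.2) (P.prod volume) := by
  classical
  have hm := hψ.measurable_apply
  refine ⟨fun p => ⨆ F : {F : Finset (ℕ × ℕ) // (F : Set (ℕ × ℕ)).PairwiseDisjoint smallBall},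
    ∑ b ∈ F.1, {p : Ω × Plane | ∃ m : ℕ, ∀ j : ℕ, ∃ k : ℕ,
      densePt k ∈ boundedRegion (Ψ p.1) m ∧
      1 / ((m : ℝ) + 1) ≤ detApprox (Ψ p.1) (densePt k) ∧
      densePt k ∈ Metric.thickening (1 / ((j : ℝ) + 1)) (smallBall b ∩ D) ∧
      ∀ i, |lensApprox (Ψ p.1) i (densePt k) - p.2 i| < 1 / ((j : ℝ) + 1)}.indicator 1 p,
    Measurable.iSup fun F => Finset.measurable_fun_sum _ fun b _ =>
      measurable_one.indicator (measurableSet_exists_image hm _), ?_⟩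
  filter_upwards [hψ.ae_prod] with p hp
  rw [hp.numPositiveParity_eq, encard_eq_iSup_smallBall]
  refine iSup_congr fun F => Finset.sum_congr rfl fun b _ => ?_
  rw [Set.indicator_apply]
  refine if_congr ?_ rfl rfl
  have hK : IsCompact (smallBall b ∩ D) := hD.inter_left Metric.isClosed_closedBall
  refine Iff.trans ?_ (hp.exists_image_iff hK p.2)
  simp only [Set.mem_inter_iff, Set.mem_ofPred_eq, and_assoc]

theorem IsRandomLensPotential.aemeasurable_posDetJac (hψ : IsRandomLensPotential P Ψ) :
    AEMeasurable (fun p : Ω × Plane => posDetJac (Ψ p.1) p.2) (P.prod volume) := by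
  have hm := hψ.measurable_apply
  refine ⟨(⋃ m, {p : Ω × Plane | p.2 ∈ boundedRegion (Ψ p.1) m}).indicator
    fun p => ENNReal.ofReal (detApprox (Ψ p.1) p.2),
    (measurable_detApprox hm).ennreal_ofReal.indicator
      (MeasurableSet.iUnion fun m => measurableSet_boundedRegion hm m), ?_⟩
  filter_upwards [hψ.ae_prod] with p hp
  have hmem : (p ∈ ⋃ m, {p : Ω × Plane | p.2 ∈ boundedRegion (Ψ p.1) m}) ↔
      p.2 ∈ lensPlane (Ψ p.1) := by
    rw [hp.mem_lensPlane_iff, Set.mem_iUnion]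
    rfl
  by_cases hL : p.2 ∈ lensPlane (Ψ p.1)
  · rw [Set.indicator_of_mem (hmem.2 hL), hp.detApprox_eq hL]
    -- No positivity cutoff is needed in the measurable version: `ENNReal.ofReal` already sends
    -- negative determinants to `0`.
    by_cases hd : 0 < detJac (Ψ p.1) p.2
    · exact Set.indicator_of_mem (s := posRegion (Ψ p.1)) ⟨hL, hd⟩ _
    · rw [ENNReal.ofReal_of_nonpos (not_lt.1 hd)]
      exact Set.indicator_of_notMem (s := posRegion (Ψ p.1)) (fun h => hd h.2) _
  · rw [Set.indicator_of_notMem (mt hmem.1 hL)]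
    exact Set.indicator_of_notMem (s := posRegion (Ψ p.1)) (fun h => hL h.1) _

/-- Integral over the source plane of the expected number of positive parity images. -/
theorem IsRandomLensPotential.lintegral_expectedPositiveParity [SFinite P]
    (hψ : IsRandomLensPotential P Ψ) {D : Set Plane} (hD : IsCompact D) :
    ∫⁻ y, expectedPositiveParity P Ψ D y = ∫⁻ x in D, ∫⁻ ω, posDetJac (Ψ ω) x ∂P := by
  have hN := hψ.aemeasurable_numPositiveParity hD
  have hJ : AEMeasurable (fun p : Ω × Plane => posDetJac (Ψ p.1) p.2)
      (P.prod (volume.restrict D)) :=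
    hψ.aemeasurable_posDetJac.mono_ac (Measure.AbsolutelyContinuous.rfl.prod
      Measure.restrict_le_self.absolutelyContinuous)
  simp only [expectedPositiveParity]
  rw [← lintegral_lintegral_swap (f := fun ω y => numPositiveParity (Ψ ω) D y) hN,
    ← lintegral_lintegral_swap (f := fun ω x => posDetJac (Ψ ω) x) hJ]
  refine lintegral_congr_ae ?_
  filter_upwards [hψ.ae_isLensPotential] with ω hω
  exact hω.lintegral_numPositiveParity hD.measurableSet

end JointMeasurability

/-! ### Averaging over the source positions -/

theorem lintegral_comp_of_isUniform {Ω' : Type*} [MeasurableSpace Ω'] {Q : Measure Ω'}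
    {X : Ω' → Plane} {s : Set Plane} (hX : pdf.IsUniform X s Q volume) (h0 : volume s ≠ 0)
    (h1 : volume s ≠ ∞) {g : Plane → ℝ≥0∞} (hg : AEMeasurable g) :
    ∫⁻ ω', g (X ω') ∂Q = (volume s)⁻¹ * ∫⁻ y in s, g y := by
  have hXm := hX.aemeasurable h0 h1
  -- The law of `X` is absolutely continuous with respect to area, so a null-measurability defect of
  -- `g` does no harm.
  rw [← lintegral_map' (hg.mono_ac hX.absolutelyContinuous) hXm, hX, ProbabilityTheory.cond,
    lintegral_smul_measure, smul_eq_mul]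

end Lensing

end

theorem mainTheorem7
    {Ω : Type*} [MeasurableSpace Ω] (P : Measure Ω) [IsProbabilityMeasure P]
    (ψ : Ω → Lensing.Plane → ℝ) (hψ : Lensing.IsRandomLensPotential P ψ)
    {ι : Type*} [Countable ι] (S : ι → Set Lensing.Plane) (a : ℝ)
    (hS : Lensing.IsEqualAreaCover S a)
    {Ω' : Type*} [MeasurableSpace Ω'] (Q : Measure Ω') [IsProbabilityMeasure Q]
    (Y : ι → Ω' → Lensing.Plane) (hY : ∀ i, pdf.IsUniform (Y i) (S i) Q volume)
    (c : Lensing.Plane) (r : ℝ) (hr : 0 < r) :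
    AEMeasurable (fun p : Ω × Lensing.Plane =>
        Lensing.numPositiveParity (ψ p.1) (Metric.closedBall c r) p.2) (P.prod volume) ∧
      AEMeasurable (fun p : Ω × Lensing.Plane => Lensing.posDetJac (ψ p.1) p.2)
        (P.prod volume) ∧
      Lensing.globalExpectation P Q ψ Y (Metric.closedBall c r) =
        1 / ENNReal.ofReal a *
          ∫⁻ x in Metric.closedBall c r, (∫⁻ ω, Lensing.posDetJac (ψ ω) x ∂P) := by
  have hD : IsCompact (Metric.closedBall c r) := isCompact_closedBall c r
  have hN := hψ.aemeasurable_numPositiveParity hD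
  refine ⟨hN, hψ.aemeasurable_posDetJac, ?_⟩
  have hE : AEMeasurable (Lensing.expectedPositiveParity P ψ (Metric.closedBall c r)) volume :=
    hN.lintegral_prod_left'
  have ha : ENNReal.ofReal a ≠ 0 := by simpa using hS.area_pos
  have hi : ∀ i, ∫⁻ ω', Lensing.expectedPositiveParity P ψ (Metric.closedBall c r) (Y i ω') ∂Q
      = (ENNReal.ofReal a)⁻¹ *
        ∫⁻ y in S i, Lensing.expectedPositiveParity P ψ (Metric.closedBall c r) y := fun i => by
    rw [Lensing.lintegral_comp_of_isUniform (hY i) (by rwa [hS.volume_eq])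
      (by simp [hS.volume_eq]) hE, hS.volume_eq]
  -- The common area factors out of the sum; null overlaps and the covering property merge the
  -- remaining integrals into one over the plane.
  rw [Lensing.globalExpectation, tsum_congr hi, ENNReal.tsum_mul_left,
    ← lintegral_iUnion₀ (fun i => (hS.isCompact i).measurableSet.nullMeasurableSet) hS.aedisjoint,
    hS.iUnion_eq, Measure.restrict_univ, hψ.lintegral_expectedPositiveParity hD, one_div]
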